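/- **Setting.** Let $(\mathcal U,g)$ be a smooth $(m+1)$-dimensional Lorentzian manifold, $g$ of signature $(-,+,\dots,+)$, let $\Phi:\mathcal U\to\mathbb R$ be smooth with $d\Phi\neq0$ on $\Phi^{-1}(0)$, and let $M=\Phi^{-1}(0)$ with its structure of embedded hypersurface. Let $g^M$ be the restriction of $g$ to $TM$ and assume that it has constant corank $k\ge1$, so that $\mathcal N=\ker g^M\subset TM$ is a distribution of rank $k$. Let $\mathcal S\subset TM$ be a smooth distribution with $TM=\mathcal N\oplus\mathcal S$. Let $\mathcal V=\mathcal V_{\mathcal N}+\mathcal V_{\mathcal S}$ be a $C^2$ vector field on $M$, decomposed accordingly. A subset of $M$ is called *bounded* if it is covered by finitely many balls of finite radius for the pseudo-distance of $g^M$, i.e. the infimum of the $g^M$-lengths $\int\sqrt{g^M(\dot\gamma,\dot\gamma)}\,dt$ of $C^1$ curves in $M$ joining two points ($\infty$ if there is none); one ball suffices if $M$ is connected. **Theorem.** Suppose that: 1. $\mathcal V$ generates a continuous closed semiflow on $M$: there are maps $(t,X_0)\mapsto X(t;X_0)$, $t\ge0$, jointly continuous, with $X(0;X_0)=X_0$,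 $X(s+t;X_0)=X(s;X(t;X_0))$ and $\dot X=\mathcal V(X)$, and $x_j\to x$, $X(t;x_j)\to y$ imply $y=X(t;x)$. 2. $\mathcal N$ is involutive, $[\mathcal V,W]\in\Gamma(\mathcal N)$ for every smooth section $W\in\Gamma(\mathcal N)$, and the leaves of the foliation $\mathscr F$ integrating $\mathcal N$ are compact and embedded. 3. The leaf space $M_{\mathrm{red}}=M/\mathscr F$ is a Hausdorff smooth manifold for which the projection $\pi:M\to M_{\mathrm{red}}$ is a smooth submersion, $g^M$ descends to a smooth Riemannian metric $g_{\mathrm{red}}$ on $M_{\mathrm{red}}$ (that is, $\pi^*g_{\mathrm{red}}=g^M$), and $(M_{\mathrm{red}},g_{\mathrm{red}})$ is complete. 4. There is a $C^1$ function $\Psi:M\to\mathbb R$, bounded below, all of whose sublevel sets $\{\Psi\le a\}$ are bounded, such that $d\Psi$ vanishes on $\mathcal N$ and, for some $c>0$, $d\Psi(\mathcal V_{\mathcal S})\le -c\,g^M(\mathcal V_{\mathcal S},\mathcal V_{\mathcal S})$ on $M$. Then the evolution is asymptotically compact: for every bounded sequence $(X_j)$ in $M$ and every sequence $t_j\to\infty$,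 the sequence $X(t_j;X_j)$ has a subsequence that converges in $M$. -/

import Mathlib

open Set Filter Topology MeasureTheory Bundle Manifold
open scoped Manifold ContDiff ENNReal NNReal

noncomputable section

/-- `ℝⁿ`, the model space of `n`-dimensional manifolds. -/
abbrev Eu (n : ℕ) : Type := EuclideanSpace ℝ (Fin n)

/-! ### Curves, distributions and leaves on a manifold -/

section Foliation

variable {m : ℕ} {M : Type*} [TopologicalSpace M] [ChartedSpace (Eu m) M]

/-- The velocity of a curve parametrised by `[0, 1]`. -/
def velocity (m : ℕ) {M : Type*} [TopologicalSpace M] [ChartedSpace (Eu m) M]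
    (γ : ℝ → M) (t : ℝ) : TangentSpace (𝓡 m) (γ t) :=
  mfderivWithin 𝓘(ℝ, ℝ) (𝓡 m) γ (Icc 0 1) t (1 : ℝ)

/-- `γ` is a `C¹` curve `[0, 1] → M` from `x` to `y` (values off `[0, 1]` are irrelevant). -/
structure IsC1Curve (m : ℕ) {M : Type*} [TopologicalSpace M] [ChartedSpace (Eu m) M]
    (γ : ℝ → M) (x y : M) : Prop where
  contMDiffOn : ContMDiffOn 𝓘(ℝ, ℝ) (𝓡 m) 1 γ (Icc 0 1)
  source : γ 0 = x
  target : γ 1 = y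

/-- A vector field of class `C^n`. -/
def IsVectorFieldOfClass [IsManifold (𝓡 m) ∞ M] (n : ℕ∞ω)
    (W : ∀ x : M, TangentSpace (𝓡 m) x) : Prop :=
  ContMDiff (𝓡 m) (𝓡 m).tangent n (fun x => (⟨x, W x⟩ : TangentBundle (𝓡 m) M))

/-- `W` is a smooth section of the distribution `D`. -/
def IsSmoothSection [IsManifold (𝓡 m) ∞ M] (D : ∀ x : M, Submodule ℝ (TangentSpace (𝓡 m) x))
    (W : ∀ x : M, TangentSpace (𝓡 m) x) : Prop :=
  IsVectorFieldOfClass ∞ W ∧ ∀ x, W x ∈ D x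

/-- Smoothness of a distribution: every vector of `D` is a value of a smooth section of `D`.
For distributions of constant rank this says that `D` is a smooth subbundle of `TM`. -/
def IsSmoothDistribution [IsManifold (𝓡 m) ∞ M]
    (D : ∀ x : M, Submodule ℝ (TangentSpace (𝓡 m) x)) : Prop :=
  ∀ x, ∀ v ∈ D x, ∃ W, IsSmoothSection D W ∧ W x = v

/-- `[W₁, W₂] ∈ Γ(D)` for all `W₁, W₂ ∈ Γ(D)`. -/
def IsInvolutive [IsManifold (𝓡 m) ∞ M]
    (D : ∀ x : M, Submodule ℝ (TangentSpace (𝓡 m) x)) : Prop :=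
  ∀ W₁ W₂, IsSmoothSection D W₁ → IsSmoothSection D W₂ →
    ∀ x, VectorField.mlieBracket (𝓡 m) W₁ W₂ x ∈ D x

/-- `[V, W] ∈ Γ(D)` for all `W ∈ Γ(D)`. -/
def PreservesDistribution [IsManifold (𝓡 m) ∞ M] (V : ∀ x : M, TangentSpace (𝓡 m) x)
    (D : ∀ x : M, Submodule ℝ (TangentSpace (𝓡 m) x)) : Prop :=
  ∀ W, IsSmoothSection D W → ∀ x, VectorField.mlieBracket (𝓡 m) V W x ∈ D x

/-- `x` and `y` are joined by a `C¹` curve that is everywhere tangent to `D`. -/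
def TangentArc (D : ∀ x : M, Submodule ℝ (TangentSpace (𝓡 m) x)) (x y : M) : Prop :=
  ∃ γ : ℝ → M, IsC1Curve m γ x y ∧ ∀ t ∈ Icc (0 : ℝ) 1, velocity m γ t ∈ D (γ t)

/-- Two points lie on the same leaf if a finite concatenation of `C¹` arcs tangent to `D` joins
them. For an involutive distribution of constant rank the classes are the leaves of the foliation
that integrates `D`. -/
def leafSetoid (D : ∀ x : M, Submodule ℝ (TangentSpace (𝓡 m) x)) : Setoid M :=
  Relation.EqvGen.setoid (TangentArc D)

/-- The leaf through `x`. -/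
def leaf (D : ∀ x : M, Submodule ℝ (TangentSpace (𝓡 m) x)) (x : M) : Set M :=
  {y | (leafSetoid D) x y}

/-- The space of leaves `M / 𝓕`, with the quotient topology. -/
def LeafSpace (D : ∀ x : M, Submodule ℝ (TangentSpace (𝓡 m) x)) : Type _ :=
  Quotient (leafSetoid D)

instance (D : ∀ x : M, Submodule ℝ (TangentSpace (𝓡 m) x)) : TopologicalSpace (LeafSpace D) :=
  inferInstanceAs (TopologicalSpace (Quotient (leafSetoid D)))

/-- The canonical projection `π : M → M / 𝓕`. -/
def leafProj (D : ∀ x : M, Submodule ℝ (TangentSpace (𝓡 m) x)) (x : M) : LeafSpace D :=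
  Quotient.mk (leafSetoid D) x

end Foliation

/-! ### Lorentzian phase spaces and constraint hypersurfaces -/

/-- A smooth Lorentzian metric, of signature `(-, +, …, +)`, on a manifold of dimension
`m + 1`. -/
structure LorentzianMetric (m : ℕ) (U : Type*) [TopologicalSpace U]
    [ChartedSpace (Eu (m + 1)) U] [IsManifold (𝓡 (m + 1)) ∞ U] where
  /-- The bilinear form on the tangent spaces. -/
  form (x : U) : TangentSpace (𝓡 (m + 1)) x →L[ℝ] TangentSpace (𝓡 (m + 1)) x →L[ℝ] ℝ
  symm (x : U) (v w : TangentSpace (𝓡 (m + 1)) x) : form x v w = form x w v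
  signature (x : U) : ∃ e : Module.Basis (Fin (m + 1)) ℝ (TangentSpace (𝓡 (m + 1)) x),
    ∀ i j, form x (e i) (e j) = if i = j then (if i = 0 then -1 else 1) else 0
  contMDiff : ContMDiff (𝓡 (m + 1))
    ((𝓡 (m + 1)).prod 𝓘(ℝ, Eu (m + 1) →L[ℝ] Eu (m + 1) →L[ℝ] ℝ)) ∞
    (fun x => TotalSpace.mk' (Eu (m + 1) →L[ℝ] Eu (m + 1) →L[ℝ] ℝ)
      (E := fun x : U =>
        TangentSpace (𝓡 (m + 1)) x →L[ℝ] TangentSpace (𝓡 (m + 1)) x →L[ℝ] ℝ) x (form x))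

/-- The level set `Φ⁻¹(0)` with the subspace topology. -/
abbrev Hypersurface {U : Type*} (Φ : U → ℝ) : Type _ := {x : U // Φ x = 0}

section Constraint

variable {m : ℕ} {U : Type*} [TopologicalSpace U] [ChartedSpace (Eu (m + 1)) U]
  [IsManifold (𝓡 (m + 1)) ∞ U] (g : LorentzianMetric m U) (Φ : U → ℝ)
  [ChartedSpace (Eu m) (Hypersurface Φ)]

/-- The restriction `g^M` of `g` to the tangent spaces of `M = Φ⁻¹(0)`. -/
def inducedForm (x : Hypersurface Φ) (v w : TangentSpace (𝓡 m) x) : ℝ :=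
  g.form x (mfderiv (𝓡 m) (𝓡 (m + 1)) (Subtype.val : Hypersurface Φ → U) x v)
    (mfderiv (𝓡 m) (𝓡 (m + 1)) (Subtype.val : Hypersurface Φ → U) x w)

/-- The null distribution `N = ker g^M`. -/
def nullDistribution (x : Hypersurface Φ) : Submodule ℝ (TangentSpace (𝓡 m) x) where
  carrier := {v | ∀ w, inducedForm g Φ x v w = 0}
  add_mem' {a b} ha hb w := by
    have ha' := ha w
    have hb' := hb w
    simp only [inducedForm] at ha' hb' ⊢
    rw [map_add, map_add, _root_.add_apply, ha', hb', add_zero]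
  zero_mem' w := by
    simp only [inducedForm]
    rw [map_zero, map_zero, _root_.zero_apply]
  smul_mem' c a ha w := by
    have ha' := ha w
    simp only [inducedForm] at ha' ⊢
    rw [map_smul, map_smul, _root_.smul_apply, ha', smul_zero]

/-- The reduced space `M_red = M / 𝓕`, the leaf space of the null distribution. -/
abbrev ReducedSpace : Type _ := LeafSpace (nullDistribution g Φ)

/-- The `g^M`-length of a curve `[0, 1] → M`. -/
def inducedLength (γ : ℝ → Hypersurface Φ) : ℝ≥0∞ :=
  ∫⁻ t in Icc (0 : ℝ) 1,
    ENNReal.ofReal (√(inducedForm g Φ (γ t) (velocity m γ t) (velocity m γ t)))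

/-- The pseudo-distance of `g^M`: the infimum of the `g^M`-lengths of `C¹` curves in `M` from `x`
to `y`. It is `∞` between different components and `0` along a leaf. -/
def inducedEDist (x y : Hypersurface Φ) : ℝ≥0∞ :=
  ⨅ (γ : ℝ → Hypersurface Φ) (_ : IsC1Curve m γ x y), inducedLength g Φ γ

/-- Bounded subsets of `M`: those covered by finitely many balls of finite radius for the
pseudo-distance of `g^M`. (One ball is enough if `M` is connected.) -/
def IsBoundedSet (s : Set (Hypersurface Φ)) : Prop :=
  ∃ (F : Finset (Hypersurface Φ)) (R : ℝ≥0), ∀ x ∈ s, ∃ p ∈ F, inducedEDist g Φ p x ≤ R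

variable [IsManifold (𝓡 m) ∞ (Hypersurface Φ)]

/-- `S` is a smooth distribution complementary to `N`, i.e. `TM = N ⊕ S`. -/
structure IsTransversalComplement
    (S : ∀ x : Hypersurface Φ, Submodule ℝ (TangentSpace (𝓡 m) x)) : Prop where
  smooth : IsSmoothDistribution S
  isCompl (x : Hypersurface Φ) : IsCompl (S x) (nullDistribution g Φ x)

variable {g Φ} in
/-- The transversal part `V_S` in the decomposition `V = V_N + V_S`. -/
def transversalPart {S : ∀ x : Hypersurface Φ, Submodule ℝ (TangentSpace (𝓡 m) x)}
    (hS : IsTransversalComplement g Φ S) (V : ∀ x : Hypersurface Φ, TangentSpace (𝓡 m) x)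
    (x : Hypersurface Φ) : TangentSpace (𝓡 m) x :=
  (Submodule.projectionOnto (S x) (nullDistribution g Φ x) (hS.isCompl x) (V x) : S x)

/-- The differential `dΨ(v)` of a real function at `x`, as a real number. -/
def differential {m : ℕ} {M : Type*} [TopologicalSpace M] [ChartedSpace (Eu m) M]
    (Ψ : M → ℝ) (x : M) (v : TangentSpace (𝓡 m) x) : ℝ :=
  mfderiv (𝓡 m) 𝓘(ℝ, ℝ) Ψ x v

variable {g Φ} in
/-- `Ψ` is a proper null-compatible functional with transversal dissipation for `V`. -/
structure IsDissipativeFunctional {S : ∀ x : Hypersurface Φ, Submodule ℝ (TangentSpace (𝓡 m) x)}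
    (hS : IsTransversalComplement g Φ S) (V : ∀ x : Hypersurface Φ, TangentSpace (𝓡 m) x)
    (Ψ : Hypersurface Φ → ℝ) : Prop where
  contMDiff : ContMDiff (𝓡 m) 𝓘(ℝ, ℝ) 1 Ψ
  bddBelow : BddBelow (range Ψ)
  /-- `dΨ` vanishes on `N`. -/
  compatible (x : Hypersurface Φ) (v : TangentSpace (𝓡 m) x) (hv : v ∈ nullDistribution g Φ x) :
    differential Ψ x v = 0
  /-- `dΨ(V_S) ≤ -c ‖V_S‖²`, with `‖·‖` the norm of `g^M` on `S`. -/
  dissipation : ∃ c : ℝ, 0 < c ∧ ∀ x : Hypersurface Φ,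
    differential Ψ x (transversalPart hS V x) ≤
      -(c * inducedForm g Φ x (transversalPart hS V x) (transversalPart hS V x))
  /-- All sublevel sets are bounded. -/
  proper (a : ℝ) : IsBoundedSet g Φ {x | Ψ x ≤ a}

end Constraint

/-! ### Semiflows -/

/-- `φ t x`, `t ≥ 0`, is a continuous closed semiflow on `M` generated by the vector field `V`.
Values at negative times are irrelevant. -/
structure IsClosedSemiflow {m : ℕ} {M : Type*} [TopologicalSpace M] [ChartedSpace (Eu m) M]
    (V : ∀ x : M, TangentSpace (𝓡 m) x) (φ : ℝ → M → M) : Prop where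
  map_zero (x : M) : φ 0 x = x
  map_add (s t : ℝ) (hs : 0 ≤ s) (ht : 0 ≤ t) (x : M) : φ (s + t) x = φ s (φ t x)
  continuousOn : ContinuousOn (fun p : ℝ × M => φ p.1 p.2) (Ici 0 ×ˢ univ)
  /-- `x_k → x` and `φ_t(x_k) → y` imply `y = φ_t(x)`. -/
  closed (t : ℝ) (ht : 0 ≤ t) (u : ℕ → M) (x y : M) (hu : Tendsto u atTop (𝓝 x))
    (hy : Tendsto (fun k => φ t (u k)) atTop (𝓝 y)) : y = φ t x
  /-- Every trajectory solves `Ẋ = V(X)` on `[0, ∞)`. -/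
  integralCurve (x : M) : IsMIntegralCurveOn (I := 𝓡 m) (fun t => φ t x) V (Ici 0)

/-- Asymptotic compactness: for every bounded sequence `X_k` and all `t_k → ∞`, the sequence
`φ_{t_k}(X_k)` has a convergent subsequence. -/
def IsAsymptoticallyCompact {M : Type*} [TopologicalSpace M] (bounded : Set M → Prop)
    (φ : ℝ → M → M) : Prop :=
  ∀ (X : ℕ → M) (t : ℕ → ℝ), bounded (range X) → Tendsto t atTop atTop →
    ∃ (σ : ℕ → ℕ) (Y : M), StrictMono σ ∧
      Tendsto (fun k => φ (t (σ k)) (X (σ k))) atTop (𝓝 Y)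

/-! ### Completeness of a Riemannian manifold -/

/-- Metric completeness for the Riemannian distance (the infimum of lengths of `C¹` curves):
every Cauchy sequence converges. -/
def IsRiemannianComplete (q : ℕ) (B : Type*) [TopologicalSpace B] [ChartedSpace (Eu q) B]
    [RiemannianBundle (fun b : B => TangentSpace (𝓡 q) b)] : Prop :=
  ∀ u : ℕ → B,
    (∀ ε : ℝ≥0∞, 0 < ε → ∃ K, ∀ i ≥ K, ∀ j ≥ K, riemannianEDist (𝓡 q) (u i) (u j) < ε) →
    ∃ b, Tendsto u atTop (𝓝 b)

end

/-! Everything reduces to the claim that bounded subsets of $M$ are relatively compact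
(`IsBoundedSet.exists_isCompact_superset`). The projection $\pi$ does not increase distances, so a
bounded set lies over finitely many closed balls of $M_{\mathrm{red}}$. These are compact by
Hopf–Rinow, proved here by a continuity argument on the radius. Finally $\pi$ is proper, since it is
open with compact connected fibres. Given the claim, $\Psi$ traps the orbits. It is bounded above by
some $a$ on the relatively compact initial data and does not increase along trajectories, so all
later states lie in $\{\Psi\le a\}$, which is bounded and hence relatively compact. -/

/-! ### Hopf–Rinow: compactness of closed balls. -/

open Metric in
/-- In a complete locally compact length space the closed balls of finite radius are compact. -/
theorem isCompact_closedEBall_of_length {X : Type*} [EMetricSpace X] [CompleteSpace X]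
    [LocallyCompactSpace X]
    (hlen : ∀ (x y : X) (r s : ℝ≥0∞), 0 < s → edist x y < r + s →
      ∃ z, edist x z ≤ r ∧ edist z y < s) (p : X) (R : ℝ) :
    IsCompact (closedEBall p (ENNReal.ofReal R)) := by
  rcases lt_or_ge R 0 with hR | hR
  · simp [ENNReal.ofReal_of_nonpos hR.le, closedEBall_zero]
  have hsub : ∀ r s : ℝ, r ≤ s → IsCompact (closedEBall p (ENNReal.ofReal s)) →
      IsCompact (closedEBall p (ENNReal.ofReal r)) := fun r s hrs hs =>
    hs.of_isClosed_subset isClosed_closedEBall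
      (closedEBall_subset_closedEBall (ENNReal.ofReal_le_ofReal hrs))
  -- Continuity argument: the radii with compact ball form a set that is closed, and open to the
  -- right, in `[0, R]`.
  have hclosed : IsClosed ({r : ℝ | IsCompact (closedEBall p (ENNReal.ofReal r))} ∩ Icc 0 R) := by
    refine IsClosed.inter (isClosed_of_closure_subset fun r hr => ?_) isClosed_Icc
    refine TotallyBounded.isCompact_of_isClosed (EMetric.totallyBounded_iff.2 fun ε hε => ?_)
      isClosed_closedEBall
    obtain ⟨δ, hδ, hδε⟩ := ENNReal.lt_iff_exists_nnreal_btwn.1 hε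
    have hδ' : (0 : ℝ) < δ := by exact_mod_cast hδ
    -- The good radius `s` may be smaller than `r`, but by less than `δ / 2`. By `hlen`, every point
    -- of the `r`-ball is then within `δ / 2` of the `s`-ball, so a finite `δ / 2`-net of the latter
    -- is a `δ`-net of the former.
    obtain ⟨s, hs, hsr⟩ := Metric.mem_closure_iff.1 hr (δ / 2) (by positivity)
    obtain ⟨t, ht, hcov⟩ := EMetric.totallyBounded_iff.1 (mem_ofPred.1 hs).totallyBounded
      (ENNReal.ofReal (δ / 2)) (by simpa using hδ')
    refine ⟨t, ht, fun x hx => ?_⟩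
    have hlt : edist p x < ENNReal.ofReal s + ENNReal.ofReal (δ / 2) := by
      rw [mem_closedEBall, edist_comm] at hx
      refine hx.trans_lt ?_
      rcases lt_or_ge r 0 with hr0 | hr0
      · rw [ENNReal.ofReal_of_nonpos hr0.le]
        exact lt_of_lt_of_le (by simpa using hδ') le_add_self
      · refine lt_of_lt_of_le ?_ ENNReal.ofReal_add_le
        rw [Real.dist_eq] at hsr
        have := (abs_lt.1 hsr).2
        exact ENNReal.ofReal_lt_ofReal_iff_of_nonneg hr0 |>.2 (by linarith)
    obtain ⟨z, hz, hzx⟩ := hlen p x _ _ (by simpa using hδ') hlt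
    obtain ⟨y, hy, hzy⟩ := mem_iUnion₂.1 (hcov (show z ∈ closedEBall p _ by
      rwa [mem_closedEBall, edist_comm]))
    refine mem_iUnion₂.2 ⟨y, hy, ?_⟩
    rw [mem_eball] at hzy ⊢
    calc edist x y ≤ edist z x + edist z y := edist_triangle_left _ _ _
      _ < ENNReal.ofReal (δ / 2) + ENNReal.ofReal (δ / 2) := ENNReal.add_lt_add hzx hzy
      _ = δ := by
        rw [← ENNReal.ofReal_add (by positivity) (by positivity), add_halves,
          ENNReal.ofReal_coe_nnreal]
      _ < ε := hδε
  refine hclosed.Icc_subset_of_forall_exists_gt (by simp) (fun r hr s hs => ?_)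
    (right_mem_Icc.2 hR)
  -- A compact neighbourhood of the `r`-ball contains its `δ`-thickening, and by `hlen` this
  -- contains the ball of radius `r + δ / 2`.
  obtain ⟨L, hL, hKL⟩ := exists_compact_superset (mem_ofPred.1 hr.1)
  obtain ⟨δ, hδ, hδL⟩ := (mem_ofPred.1 hr.1).exists_thickening_subset_open isOpen_interior hKL
  have hs' : r < s := hs
  refine ⟨min s (r + δ / 2), hsub _ (r + δ / 2) (min_le_right _ _) ?_,
    lt_min hs' (by linarith), min_le_left _ _⟩
  refine hL.of_isClosed_subset isClosed_closedEBall fun x hx => interior_subset (hδL ?_)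
  have hlt : edist p x < ENNReal.ofReal r + ENNReal.ofReal δ := by
    rw [mem_closedEBall, edist_comm] at hx
    rw [← ENNReal.ofReal_add hr.2.1 hδ.le]
    exact hx.trans_lt ((ENNReal.ofReal_lt_ofReal_iff (by linarith [hr.2.1])).2 (by linarith))
  obtain ⟨z, hz, hzx⟩ := hlen p x _ _ (by simpa using hδ) hlt
  rw [Metric.mem_thickening_iff_exists_edist_lt]
  exact ⟨z, by rwa [mem_closedEBall, edist_comm], by rwa [edist_comm]⟩

/-- The closed balls of finite radius of a complete Riemannian manifold are compact. -/
theorem IsRiemannianComplete.isCompact_riemannianEDist_le {q : ℕ} {B : Type*}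
    [TopologicalSpace B] [T2Space B] [ChartedSpace (Eu q) B] [IsManifold (𝓡 q) ∞ B]
    [RiemannianBundle (fun b : B => TangentSpace (𝓡 q) b)]
    [IsContMDiffRiemannianBundle (𝓡 q) ∞ (Eu q) (fun b : B => TangentSpace (𝓡 q) b)]
    (h : IsRiemannianComplete q B) (p : B) (R : ℝ≥0) :
    IsCompact {x | riemannianEDist (𝓡 q) p x ≤ R} := by
  have : IsManifold (𝓡 q) 1 B := .of_le (n := ∞) (by simp)
  have : LocallyCompactSpace B := ChartedSpace.locallyCompactSpace (Eu q) B
  have : IsContinuousRiemannianBundle (Eu q) (fun b : B => TangentSpace (𝓡 q) b) := by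
    obtain ⟨g, hg, h⟩ := IsContMDiffRiemannianBundle.exists_contMDiff (IB := 𝓡 q) (n := ∞)
      (F := Eu q) (E := fun b : B => TangentSpace (𝓡 q) b)
    exact ⟨g, hg.continuous, h⟩
  let : EMetricSpace B := .ofRiemannianMetric (𝓡 q) B
  have hdist : ∀ x y : B, edist x y = riemannianEDist (𝓡 q) x y := fun _ _ => rfl
  have : CompleteSpace B := EMetric.complete_of_cauchySeq_tendsto fun u hu =>
    h u (EMetric.cauchySeq_iff.1 hu)
  have key := isCompact_closedEBall_of_length (X := B) ?_ p R
  · have hset : {x | riemannianEDist (𝓡 q) p x ≤ R} =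
        Metric.closedEBall p (ENNReal.ofReal R) := by
      ext x
      rw [mem_ofPred_eq, Metric.mem_closedEBall, edist_comm, ENNReal.ofReal_coe_nnreal, hdist]
    rw [hset]
    exact key
  intro x y r s hs hxy
  rcases le_or_gt (edist x y) r with hle | hgt
  · exact ⟨y, hle, by rwa [edist_self]⟩
  -- Cut a curve of length less than `r + s` where its distance from `x` equals `r`. The first piece
  -- has length at least `r`, so the second is shorter than `s`.
  obtain ⟨γ, h0, h1, hγ, hl⟩ := exists_lt_of_riemannianEDist_lt (I := 𝓡 q) hxy
  have hcont : ContinuousOn (fun t => edist x (γ t)) (Icc 0 1) :=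
    (continuous_const.edist continuous_id).comp_continuousOn hγ.continuousOn
  obtain ⟨t, ht, hxt⟩ := intermediate_value_Icc zero_le_one hcont
    (show r ∈ Icc _ _ by simp [h0, h1, hgt.le])
  have hxt : edist x (γ t) = r := hxt
  refine ⟨γ t, hxt.le, ?_⟩
  have hle₁ : r ≤ pathELength (𝓡 q) γ 0 t := by
    rw [← hxt, hdist]
    exact riemannianEDist_le_pathELength (hγ.mono (Icc_subset_Icc le_rfl ht.2)) h0 rfl ht.1
  have hle₂ : edist (γ t) y ≤ pathELength (𝓡 q) γ t 1 :=
    riemannianEDist_le_pathELength (hγ.mono (Icc_subset_Icc ht.1 le_rfl)) rfl h1 ht.2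
  rw [← pathELength_add ht.1 ht.2] at hl
  exact lt_of_add_lt_add_left (((add_le_add hle₁ hle₂).trans_lt hl))

/-! ### Open maps and properness. -/

/-- A map that reads as a linear projection in suitable charts around `x` maps neighbourhoods
of `x` to neighbourhoods of its image. -/
theorem nhds_le_map_of_eqOn_fst {E E' F H G M N : Type*}
    [NormedAddCommGroup E] [NormedSpace ℝ E] [NormedAddCommGroup E'] [NormedSpace ℝ E']
    [NormedAddCommGroup F] [NormedSpace ℝ F] [TopologicalSpace H] [TopologicalSpace G]
    {I : ModelWithCorners ℝ E H} {J : ModelWithCorners ℝ E' G} [I.Boundaryless] [J.Boundaryless]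
    [TopologicalSpace M] [TopologicalSpace N] {f : M → N} {x : M}
    {e : OpenPartialHomeomorph M H} {e' : OpenPartialHomeomorph N G} {L : E ≃L[ℝ] (E' × F)}
    (hx : x ∈ e.source) (hsource : e.source ⊆ f ⁻¹' e'.source)
    (hf : EqOn (e'.extend J ∘ f ∘ (e.extend I).symm) (Prod.fst ∘ L) (e.extend I).target) :
    𝓝 (f x) ≤ map f (𝓝 x) := by
  have hval : ∀ y ∈ e.source, e'.extend J (f y) = (L (e.extend I y)).1 := fun y hy => by
    have := hf ((e.extend I).map_source (by rwa [e.extend_source]))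
    rwa [Function.comp_apply, Function.comp_apply, e.extend_left_inv hy] at this
  -- Each factor carries the neighbourhood filter of a point exactly onto that of its image. For the
  -- charts this uses that the models have no boundary.
  have hev : f =ᶠ[𝓝 x] (e'.extend J).symm ∘ Prod.fst ∘ L ∘ e.extend I := by
    filter_upwards [e.open_source.mem_nhds hx] with y hy
    simp only [Function.comp_apply]
    rw [← hval y hy, e'.extend_left_inv (hsource hy)]
  have hsymm : map (e'.extend J).symm (𝓝 (e'.extend J (f x))) = 𝓝 (f x) := by
    have := e'.map_extend_symm_nhdsWithin_range (I := J) (hsource hx)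
    rwa [J.range_eq_univ, nhdsWithin_univ] at this
  have hL : map L (𝓝 (e.extend I x)) = 𝓝 (L (e.extend I x)) := L.toHomeomorph.map_nhds_eq _
  rw [Filter.map_congr hev, ← Filter.map_map, ← Filter.map_map, ← Filter.map_map,
    e.map_extend_nhds_of_boundaryless hx, hL, map_fst_nhds, ← hval x hx, hsymm]

/-- Submersions between manifolds without boundary are open maps. -/
theorem Manifold.IsSubmersion.isOpenMap {E E' H G M N : Type*}
    [NormedAddCommGroup E] [NormedSpace ℝ E] [NormedAddCommGroup E'] [NormedSpace ℝ E']
    [TopologicalSpace H] [TopologicalSpace G]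
    {I : ModelWithCorners ℝ E H} {J : ModelWithCorners ℝ E' G} [I.Boundaryless] [J.Boundaryless]
    [TopologicalSpace M] [ChartedSpace H M] [TopologicalSpace N] [ChartedSpace G N] {n : ℕ∞ω}
    {f : M → N} (hf : IsSubmersion I J n f) : IsOpenMap f :=
  isOpenMap_iff_nhds_le.2 fun x =>
    have h := hf.isSubmersionAt x
    nhds_le_map_of_eqOn_fst h.mem_domChart_source h.source_subset_preimage_source
      h.writtenInCharts

/-- A continuous open map onto a Hausdorff space with compact connected fibres is proper, as soon
as its source is locally compact Hausdorff. -/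
theorem IsOpenMap.isCompact_preimage_of_isPreconnected_fiber {X Y : Type*} [TopologicalSpace X]
    [TopologicalSpace Y] [T2Space X] [LocallyCompactSpace X] [T2Space Y] {f : X → Y}
    (hf : Continuous f) (hopen : IsOpenMap f) (hsurj : Function.Surjective f)
    (hcomp : ∀ y, IsCompact (f ⁻¹' {y})) (hconn : ∀ y, IsPreconnected (f ⁻¹' {y}))
    {K : Set Y} (hK : IsCompact K) : IsCompact (f ⁻¹' K) := by
  have hloc : ∀ y, ∃ t ∈ 𝓝 y, ∃ L, IsCompact L ∧ f ⁻¹' t ⊆ L := by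
    intro y
    obtain ⟨L, hL, hyL⟩ := exists_compact_superset (hcomp y)
    have hfr : IsCompact (frontier L) := hL.of_isClosed_subset isClosed_frontier
      (frontier_subset_closure.trans hL.isClosed.closure_eq.subset)
    -- A fibre over this set meets `interior L` and misses `frontier L`. Being connected, it cannot
    -- leave `interior L`.
    refine ⟨f '' interior L ∩ (f '' frontier L)ᶜ, inter_mem ?_ ?_, L, hL, ?_⟩
    · obtain ⟨x, rfl⟩ := hsurj y
      exact (hopen _ isOpen_interior).mem_nhds (mem_image_of_mem f (hyL rfl))
    · refine (hfr.image hf).isClosed.isOpen_compl.mem_nhds ?_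
      rintro ⟨x, hx, hxy⟩
      exact hx.2 (hyL hxy)
    · rintro x ⟨⟨z, hz, hzx⟩, hx⟩
      have hfib : f ⁻¹' {f x} ⊆ interior L := by
        refine (hconn (f x)).subset_left_of_subset_union isOpen_interior
          hL.isClosed.isOpen_compl ?_ ?_ ⟨z, hzx, hz⟩
        · exact disjoint_compl_right.mono_left interior_subset
        · intro w hw
          by_contra hcon
          rw [mem_union, not_or, mem_compl_iff, not_not] at hcon
          exact hx ⟨w, ⟨subset_closure hcon.2, hcon.1⟩, hw⟩
      exact interior_subset (hfib rfl)
  obtain ⟨L, hL, hKL⟩ : ∃ L, IsCompact L ∧ f ⁻¹' K ⊆ L := by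
    refine hK.induction_on (p := fun K => ∃ L, IsCompact L ∧ f ⁻¹' K ⊆ L) ⟨∅, by simp⟩ ?_ ?_ ?_
    · rintro s t hst ⟨L, hL, h⟩
      exact ⟨L, hL, (preimage_mono hst).trans h⟩
    · rintro s t ⟨L, hL, h⟩ ⟨L', hL', h'⟩
      exact ⟨L ∪ L', hL.union hL', by rw [preimage_union]; exact union_subset_union h h'⟩
    · intro y _
      obtain ⟨t, ht, L, hL, h⟩ := hloc y
      exact ⟨t, mem_nhdsWithin_of_mem_nhds ht, L, hL, h⟩
  exact hL.of_isClosed_subset (hK.isClosed.preimage hf) hKL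

/-! ### Leaves as connected fibres of the projection. -/

section Leaves

variable {m : ℕ} {M : Type*} [TopologicalSpace M] [ChartedSpace (Eu m) M]

theorem leafProj_surjective (D : ∀ x : M, Submodule ℝ (TangentSpace (𝓡 m) x)) :
    Function.Surjective (leafProj D) :=
  Quotient.mk_surjective

theorem leafProj_eq_iff {D : ∀ x : M, Submodule ℝ (TangentSpace (𝓡 m) x)} {x y : M} :
    leafProj D x = leafProj D y ↔ y ∈ leaf D x :=
  Quotient.eq

theorem leafProj_preimage_singleton (D : ∀ x : M, Submodule ℝ (TangentSpace (𝓡 m) x)) (x : M) :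
    leafProj D ⁻¹' {leafProj D x} = leaf D x := by
  ext y
  rw [mem_preimage, mem_singleton_iff, eq_comm, leafProj_eq_iff]

theorem leaf_eq_leaf {D : ∀ x : M, Submodule ℝ (TangentSpace (𝓡 m) x)} {x y : M}
    (h : y ∈ leaf D x) : leaf D y = leaf D x := by
  rw [← leafProj_preimage_singleton, ← leafProj_preimage_singleton, leafProj_eq_iff.2 h]

/-- Initial pieces of arcs tangent to `D` are tangent to `D`. -/
theorem IsC1Curve.tangentArc_initial {D : ∀ x : M, Submodule ℝ (TangentSpace (𝓡 m) x)}
    {γ : ℝ → M} {x y : M} (hγ : IsC1Curve m γ x y)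
    (hD : ∀ t ∈ Icc (0 : ℝ) 1, velocity m γ t ∈ D (γ t)) {t : ℝ} (ht : t ∈ Icc (0 : ℝ) 1) :
    TangentArc D x (γ t) := by
  have hmaps : MapsTo (fun s : ℝ => t * s) (Icc 0 1) (Icc 0 1) := fun s hs =>
    ⟨mul_nonneg ht.1 hs.1, mul_le_one₀ ht.2 hs.1 hs.2⟩
  have hmul : ∀ s, HasMFDerivWithinAt 𝓘(ℝ, ℝ) 𝓘(ℝ, ℝ) (fun s : ℝ => t * s) (Icc 0 1) s
      (ContinuousLinearMap.toSpanSingleton ℝ t) := fun s => by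
    have h := ((hasDerivAt_id s).const_mul t).hasDerivWithinAt (s := Icc 0 1)
    rw [mul_one] at h
    exact h.hasFDerivWithinAt.hasMFDerivWithinAt
  refine ⟨fun s => γ (t * s), ⟨?_, ?_, ?_⟩, fun s hs => ?_⟩
  · refine hγ.contMDiffOn.comp (ContDiff.contMDiff ?_).contMDiffOn hmaps
    fun_prop
  · simp [hγ.source]
  · simp
  · have hd := ((hγ.contMDiffOn (t * s) (hmaps hs)).mdifferentiableWithinAt
      one_ne_zero).hasMFDerivWithinAt
    have hcomp := HasMFDerivWithinAt.comp s hd (hmul s) hmaps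
    have hu : UniqueMDiffWithinAt 𝓘(ℝ, ℝ) (Icc (0 : ℝ) 1) s :=
      (uniqueDiffOn_Icc zero_lt_one s hs).uniqueMDiffWithinAt
    have hvel : velocity m (fun s => γ (t * s)) s = t • velocity m γ (t * s) := by
      have h1 := hcomp.mfderivWithin hu
      have h2 := congrArg (fun A => A (1 : ℝ)) h1
      refine h2.trans ?_
      have h3 : ContinuousLinearMap.toSpanSingleton ℝ t (1 : ℝ) = t • (1 : ℝ) := by simp
      exact (congrArg (mfderivWithin 𝓘(ℝ, ℝ) (𝓡 m) γ (Icc 0 1) (t * s)) h3).trans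
        (map_smul (mfderivWithin 𝓘(ℝ, ℝ) (𝓡 m) γ (Icc 0 1) (t * s)) t (1 : ℝ))
    rw [hvel]
    exact Submodule.smul_mem _ _ (hD _ (hmaps hs))

/-- By induction on the generation of the equivalence, each point is joined to the base point by a
connected set inside the leaf. Tangent arcs stay in the leaf because their initial pieces are again
tangent arcs. -/
theorem isPreconnected_leaf (D : ∀ x : M, Submodule ℝ (TangentSpace (𝓡 m) x)) (x : M) :
    IsPreconnected (leaf D x) := by
  refine isPreconnected_of_forall x fun y hy => ?_
  have hy : Relation.EqvGen (TangentArc D) x y := hy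
  induction hy with
  | rel a b h =>
    obtain ⟨γ, hγ, hD⟩ := h
    refine ⟨γ '' Icc 0 1, ?_, ⟨0, by simp, hγ.source⟩, ⟨1, by simp, hγ.target⟩,
      isPreconnected_Icc.image _ hγ.contMDiffOn.continuousOn⟩
    rintro _ ⟨t, ht, rfl⟩
    exact Relation.EqvGen.rel _ _ (hγ.tangentArc_initial hD ht)
  | refl a =>
    exact ⟨{a}, singleton_subset_iff.2 (Relation.EqvGen.refl a), rfl, rfl,
      isPreconnected_singleton⟩
  | symm a b h ih =>
    obtain ⟨s, hs, ha, hb, hc⟩ := ih h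
    exact ⟨s, by rwa [leaf_eq_leaf h], hb, ha, hc⟩
  | trans a b c h h' ih ih' =>
    obtain ⟨s, hs, ha, hb, hc⟩ := ih h
    obtain ⟨s', hs', ha', hb', hc'⟩ := ih' h'
    exact ⟨s ∪ s', union_subset hs (by rwa [← leaf_eq_leaf h]), .inl ha, .inr hb',
      hc.union b hb ha' hc'⟩

end Leaves

/-! ### Monotonicity of the functional and relative compactness of bounded sets. -/

section Constraint

variable {m q : ℕ} {U : Type*} [TopologicalSpace U] [ChartedSpace (Eu (m + 1)) U]
  [IsManifold (𝓡 (m + 1)) ∞ U] {g : LorentzianMetric m U} {Φ : U → ℝ}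
  [ChartedSpace (Eu m) (Hypersurface Φ)]

/-- A null-compatible dissipative functional does not increase along trajectories. -/
theorem IsDissipativeFunctional.antitoneOn [IsManifold (𝓡 m) ∞ (Hypersurface Φ)]
    {S : ∀ x : Hypersurface Φ, Submodule ℝ (TangentSpace (𝓡 m) x)}
    {hS : IsTransversalComplement g Φ S} {V : ∀ x : Hypersurface Φ, TangentSpace (𝓡 m) x}
    {Ψ : Hypersurface Φ → ℝ} (hΨ : IsDissipativeFunctional hS V Ψ)
    (hnonneg : ∀ (x : Hypersurface Φ) (v : TangentSpace (𝓡 m) x), 0 ≤ inducedForm g Φ x v v)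
    {γ : ℝ → Hypersurface Φ} (hγ : IsMIntegralCurveOn (I := 𝓡 m) γ V (Ici 0)) :
    AntitoneOn (fun t => Ψ (γ t)) (Ici 0) := by
  have hder : ∀ t ∈ Ici (0 : ℝ),
      HasDerivWithinAt (fun t => Ψ (γ t)) (differential Ψ (γ t) (V (γ t))) (Ici 0) t := by
    intro t ht
    have hp := ((hΨ.contMDiff (γ t)).mdifferentiableAt one_ne_zero).hasMFDerivAt
    let A : ℝ →L[ℝ] ℝ := ContinuousLinearMap.comp (mfderiv (𝓡 m) 𝓘(ℝ, ℝ) Ψ (γ t))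
      ((1 : ℝ →L[ℝ] ℝ).smulRight (V (γ t)))
    have hcomp : HasFDerivWithinAt (fun t => Ψ (γ t)) A (Ici 0) t :=
      (hp.comp_hasMFDerivWithinAt t (hγ t ht)).hasFDerivWithinAt
    refine hcomp.hasDerivWithinAt.congr_deriv ?_
    have : (1 : ℝ) • V (γ t) = V (γ t) := one_smul _ _
    exact congrArg (fun v => mfderiv (𝓡 m) 𝓘(ℝ, ℝ) Ψ (γ t) v) this
  -- Since $d\Psi$ kills $\mathcal V_{\mathcal N}$, only $d\Psi(\mathcal V_{\mathcal S})\le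
  -- -c\,g^M(\mathcal V_{\mathcal S},\mathcal V_{\mathcal S})\le 0$ remains.
  have hsign : ∀ x, differential Ψ x (V x) ≤ 0 := by
    intro x
    obtain ⟨c, hc, hdiss⟩ := hΨ.dissipation
    have hnull : V x - transversalPart hS V x ∈ nullDistribution g Φ x := by
      rw [← Submodule.projectionOnto_apply_eq_zero_iff (hS.isCompl x), map_sub, sub_eq_zero]
      exact (Submodule.projectionOnto_apply_left (hS.isCompl x) _).symm
    have h0 : differential Ψ x (V x) - differential Ψ x (transversalPart hS V x) = 0 :=
      (map_sub (mfderiv (𝓡 m) 𝓘(ℝ, ℝ) Ψ x) (V x) (transversalPart hS V x)).symm.trans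
        (hΨ.compatible x _ hnull)
    have := mul_nonneg hc.le (hnonneg x (transversalPart hS V x))
    linarith [hdiss x]
  refine antitoneOn_of_hasDerivWithinAt_nonpos (convex_Ici 0)
    (fun t ht => (hder t ht).continuousWithinAt)
    (fun t ht => (hder t (interior_subset ht)).mono interior_subset) fun t _ => hsign _

variable [ChartedSpace (Eu q) (ReducedSpace g Φ)]
  [RiemannianBundle (fun b : ReducedSpace g Φ => TangentSpace (𝓡 q) b)]

/-- A Lorentzian $g$ may restrict to an indefinite form. Here $g^M$ is semidefinite because it is
the pullback of a Riemannian metric, and this gives the dissipation its sign. -/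
theorem inducedForm_self_nonneg
    (hred : ∀ (x : Hypersurface Φ) (v w : TangentSpace (𝓡 m) x),
      inner ℝ (mfderiv (𝓡 m) (𝓡 q) (leafProj (nullDistribution g Φ)) x v)
        (mfderiv (𝓡 m) (𝓡 q) (leafProj (nullDistribution g Φ)) x w) = inducedForm g Φ x v w)
    (x : Hypersurface Φ) (v : TangentSpace (𝓡 m) x) : 0 ≤ inducedForm g Φ x v v := by
  rw [← hred]
  exact real_inner_self_nonneg

/-- The projection to the reduced space does not increase distances. -/
theorem riemannianEDist_leafProj_le
    (hπ : ContMDiff (𝓡 m) (𝓡 q) ∞ (leafProj (nullDistribution g Φ)))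
    (hred : ∀ (x : Hypersurface Φ) (v w : TangentSpace (𝓡 m) x),
      inner ℝ (mfderiv (𝓡 m) (𝓡 q) (leafProj (nullDistribution g Φ)) x v)
        (mfderiv (𝓡 m) (𝓡 q) (leafProj (nullDistribution g Φ)) x w) = inducedForm g Φ x v w)
    (x y : Hypersurface Φ) :
    riemannianEDist (𝓡 q) (leafProj (nullDistribution g Φ) x)
      (leafProj (nullDistribution g Φ) y) ≤ inducedEDist g Φ x y := by
  refine le_iInf₂ fun γ hγ => ?_
  have hC : ContMDiffOn 𝓘(ℝ, ℝ) (𝓡 q) 1 (leafProj (nullDistribution g Φ) ∘ γ) (Icc 0 1) :=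
    (hπ.of_le (by simp)).comp_contMDiffOn hγ.contMDiffOn
  refine (riemannianEDist_le_pathELength hC (by simp [hγ.source]) (by simp [hγ.target])
    zero_le_one).trans ?_
  rw [pathELength_eq_lintegral_mfderivWithin_Icc, inducedLength]
  -- The two lengths agree, integrand by integrand: $d\pi$ carries $g^M$ to $g_{\mathrm{red}}$.
  refine (setLIntegral_congr_fun measurableSet_Icc fun t ht => ?_).le
  have hu : UniqueMDiffWithinAt 𝓘(ℝ, ℝ) (Icc (0 : ℝ) 1) t :=
    (uniqueDiffOn_Icc zero_lt_one t ht).uniqueMDiffWithinAt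
  have hd := ((hγ.contMDiffOn t ht).mdifferentiableWithinAt one_ne_zero).hasMFDerivWithinAt
  have hp := ((hπ (γ t)).mdifferentiableAt (by simp)).hasMFDerivAt
  have hcomp := (hp.comp_hasMFDerivWithinAt t hd).mfderivWithin hu
  have hval : mfderivWithin 𝓘(ℝ, ℝ) (𝓡 q) (leafProj (nullDistribution g Φ) ∘ γ) (Icc 0 1) t
      (1 : ℝ) = mfderiv (𝓡 m) (𝓡 q) (leafProj (nullDistribution g Φ)) (γ t) (velocity m γ t) :=
    congrArg (fun A => A (1 : ℝ)) hcomp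
  refine (congrArg (fun w : TangentSpace (𝓡 q) (leafProj (nullDistribution g Φ) (γ t)) => ‖w‖ₑ)
    hval).trans ?_
  rw [← hred, ← norm_eq_sqrt_real_inner, ofReal_norm]

/-- Bounded subsets of `M` are relatively compact. -/
theorem IsBoundedSet.exists_isCompact_superset
    [IsManifold (𝓡 m) ∞ (Hypersurface Φ)] [IsManifold (𝓡 q) ∞ (ReducedSpace g Φ)]
    [T2Space U] [T2Space (ReducedSpace g Φ)]
    [IsContMDiffRiemannianBundle (𝓡 q) ∞ (Eu q)
      (fun b : ReducedSpace g Φ => TangentSpace (𝓡 q) b)]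
    (hleaf : ∀ x : Hypersurface Φ, IsCompact (leaf (nullDistribution g Φ) x))
    (hπ : IsSubmersion (𝓡 m) (𝓡 q) ∞ (leafProj (nullDistribution g Φ)))
    (hred : ∀ (x : Hypersurface Φ) (v w : TangentSpace (𝓡 m) x),
      inner ℝ (mfderiv (𝓡 m) (𝓡 q) (leafProj (nullDistribution g Φ)) x v)
        (mfderiv (𝓡 m) (𝓡 q) (leafProj (nullDistribution g Φ)) x w) = inducedForm g Φ x v w)
    (hcomplete : IsRiemannianComplete q (ReducedSpace g Φ))
    {s : Set (Hypersurface Φ)} (hs : IsBoundedSet g Φ s) :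
    ∃ K, IsCompact K ∧ s ⊆ K := by
  obtain ⟨F, R, hF⟩ := hs
  have : LocallyCompactSpace (Hypersurface Φ) :=
    ChartedSpace.locallyCompactSpace (Eu m) (Hypersurface Φ)
  have hK : IsCompact (⋃ p ∈ F, {b | riemannianEDist (𝓡 q)
      (leafProj (nullDistribution g Φ) p) b ≤ R}) :=
    F.isCompact_biUnion fun p _ => hcomplete.isCompact_riemannianEDist_le _ R
  have hfib : ∀ b, ∃ x, leafProj (nullDistribution g Φ) ⁻¹' {b} = leaf _ x := fun b => by
    obtain ⟨x, rfl⟩ := leafProj_surjective _ b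
    exact ⟨x, leafProj_preimage_singleton _ x⟩
  refine ⟨_, hπ.isOpenMap.isCompact_preimage_of_isPreconnected_fiber hπ.contMDiff.continuous
    (leafProj_surjective _) (fun b => ?_) (fun b => ?_) hK, fun x hx => ?_⟩
  · obtain ⟨x, hx⟩ := hfib b
    rw [hx]
    exact hleaf x
  · obtain ⟨x, hx⟩ := hfib b
    rw [hx]
    exact isPreconnected_leaf _ x
  · obtain ⟨p, hp, hpx⟩ := hF x hx
    exact mem_iUnion₂.2 ⟨p, hp, (riemannianEDist_leafProj_le hπ.contMDiff hred p x).trans hpx⟩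

end Constraint

theorem theorem1
    {m k q : ℕ} (hk : 1 ≤ k)
    -- the ambient Lorentzian phase space, of dimension `n = m + 1`
    {U : Type*} [TopologicalSpace U] [T2Space U] [SecondCountableTopology U]
    [ChartedSpace (Eu (m + 1)) U] [IsManifold (𝓡 (m + 1)) ∞ U]
    (g : LorentzianMetric m U)
    -- the constraint hypersurface `M = Φ⁻¹(0)`, with its structure of embedded submanifold
    (Φ : U → ℝ) (hΦ : ContMDiff (𝓡 (m + 1)) 𝓘(ℝ, ℝ) ∞ Φ)
    (hreg : ∀ x : U, Φ x = 0 → mfderiv (𝓡 (m + 1)) 𝓘(ℝ, ℝ) Φ x ≠ 0)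
    [ChartedSpace (Eu m) (Hypersurface Φ)] [IsManifold (𝓡 m) ∞ (Hypersurface Φ)]
    (hemb : IsSmoothEmbedding (𝓡 m) (𝓡 (m + 1)) ∞ (Subtype.val : Hypersurface Φ → U))
    -- the null distribution has constant rank `k`, is involutive, and has a complement `S`
    (hcorank : ∀ x : Hypersurface Φ, Module.finrank ℝ (nullDistribution g Φ x) = k)
    (hinv : IsInvolutive (nullDistribution g Φ))
    (S : ∀ x : Hypersurface Φ, Submodule ℝ (TangentSpace (𝓡 m) x))
    (hS : IsTransversalComplement g Φ S)
    -- the leaves are compact, and the leaf space `M_red` is a Hausdorff manifold for which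
    -- the projection is a submersion (so that the leaves are embedded)
    (hleaf : ∀ x : Hypersurface Φ, IsCompact (leaf (nullDistribution g Φ) x))
    [T2Space (ReducedSpace g Φ)] [ChartedSpace (Eu q) (ReducedSpace g Φ)]
    [IsManifold (𝓡 q) ∞ (ReducedSpace g Φ)]
    (hπ : IsSubmersion (𝓡 m) (𝓡 q) ∞ (leafProj (nullDistribution g Φ)))
    -- the Riemannian metric induced on `M_red` by `g^M`; it is complete
    [RiemannianBundle (fun b : ReducedSpace g Φ => TangentSpace (𝓡 q) b)]
    [IsContMDiffRiemannianBundle (𝓡 q) ∞ (Eu q)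
      (fun b : ReducedSpace g Φ => TangentSpace (𝓡 q) b)]
    (hred : ∀ (x : Hypersurface Φ) (v w : TangentSpace (𝓡 m) x),
      inner ℝ (mfderiv (𝓡 m) (𝓡 q) (leafProj (nullDistribution g Φ)) x v)
        (mfderiv (𝓡 m) (𝓡 q) (leafProj (nullDistribution g Φ)) x w) = inducedForm g Φ x v w)
    (hcomplete : IsRiemannianComplete q (ReducedSpace g Φ))
    -- the intrinsic vector field, which preserves the null foliation, and its semiflow
    (V : ∀ x : Hypersurface Φ, TangentSpace (𝓡 m) x) (hV : IsVectorFieldOfClass 2 V)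
    (hproj : PreservesDistribution V (nullDistribution g Φ))
    (φ : ℝ → Hypersurface Φ → Hypersurface Φ) (hφ : IsClosedSemiflow V φ)
    -- the null-compatible functional
    (hΨ : ∃ Ψ : Hypersurface Φ → ℝ, IsDissipativeFunctional hS V Ψ) :
    IsAsymptoticallyCompact (IsBoundedSet g Φ) φ := by
  obtain ⟨Ψ, hΨ⟩ := hΨ
  intro X t hX ht
  obtain ⟨K, hK, hXK⟩ := hX.exists_isCompact_superset hleaf hπ hred hcomplete
  obtain ⟨a, ha⟩ := hK.bddAbove_image hΨ.contMDiff.continuous.continuousOn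
  obtain ⟨L, hL, hΨL⟩ := (hΨ.proper a).exists_isCompact_superset hleaf hπ hred hcomplete
  -- First countability lets compactness of `L` yield convergent subsequences.
  have : FirstCountableTopology (Hypersurface Φ) :=
    IsInducing.subtypeVal.firstCountableTopology
  -- The semiflow is controlled only for nonnegative times, so the finitely many indices before
  -- `n₀`, where `t` may be negative, are skipped.
  obtain ⟨n₀, hn₀⟩ := eventually_atTop.1 (ht.eventually_ge_atTop 0)
  have hmem : ∀ n, φ (t (n + n₀)) (X (n + n₀)) ∈ L := fun n => hΨL <| by
    have ht0 : 0 ≤ t (n + n₀) := hn₀ _ (by omega)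
    have hanti := hΨ.antitoneOn (inducedForm_self_nonneg hred) (hφ.integralCurve (X (n + n₀)))
      (mem_Ici.2 le_rfl) (mem_Ici.2 ht0) ht0
    simp only [hφ.map_zero] at hanti
    exact hanti.trans (ha (mem_image_of_mem Ψ (hXK (mem_range_self _))))
  obtain ⟨Y, _, σ, hσ, hlim⟩ := hL.tendsto_subseq hmem
  exact ⟨fun n => σ n + n₀, Y, fun i j hij => Nat.add_lt_add_right (hσ hij) n₀, hlim⟩
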